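/- Let $\mathcal H$ and $\mathcal G$ be real Hilbert spaces, let $V\subset\mathcal H$ and $W\subset\mathcal G$ be closed vector subspaces with orthogonal projections $P_V$ and $P_W$, and let $N_V$ be the normal cone to $V$ ($N_Vx=V^\perp$ if $x\in V$, and $N_Vx=\varnothing$ otherwise). Let $T\colon\mathcal H\to\mathcal H$ be $\alpha$-averaged nonexpansive for some $\alpha\in\,]0,1[$, i.e. $\|Tx-Ty\|^2\le\|x-y\|^2-\frac{1-\alpha}{\alpha}\|(\mathrm{Id}-T)x-(\mathrm{Id}-T)y\|^2$ for all $x,y\in\mathcal H$. Let $L\colon\mathcal H\to\mathcal G$ be a bounded linear operator with $\operatorname{ran}L\subset W$. Let $A\colon\mathcal H\rightrightarrows\mathcal H$ and $B,D\colon\mathcal G\rightrightarrows\mathcal G$ be maximally monotone set-valued operators. Let $\beta,\delta\in\,]0,+\infty]$, let $C\colon\mathcal H\to\mathcal H$ be $\beta$-cocoercive, i.e. $\langle x-y\mid Cx-Cy\rangle\ge\beta\|Cx-Cy\|^2$ for all $x,y\in\mathcal H$, and let $D$ be $\delta$-strongly monotone, i.e. $\langle x-y\mid u-v\rangle\ge\delta\|x-y\|^2$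 for all $u\in Dx$, $v\in Dy$ (with the conventions $+\infty\cdot 0=0$ and $1/(+\infty)=0$). Consider the problem $$\text{find }(x,u)\in(V\cap\operatorname{Fix}T)\times W\text{ such that }\quad 0\in Ax+Cx+L^*u+N_Vx\quad\text{and}\quad 0\in B^{-1}u+D^{-1}u-Lx, \tag{$\mathcal I$}$$ and assume that it has at least one solution. Let $\tau\in\,]0,2\beta[$ and $\gamma\in\,]0,2\delta[$ be real numbers such that $$\|L\|^2<\Big(\frac1\tau-\frac1{2\beta}\Big)\Big(\frac1\gamma-\frac1{2\delta}\Big).$$ Let $x^0\in V$, $\overline x^0=x^0$, $y^0\in V^\perp$, $u^0\in\mathcal G$, and let sequences be generated, for every $k\in\mathbb N$, by $$\begin{aligned} \eta^{k+1}&=J_{\gamma B^{-1}}\big(u^k+\gamma(L\overline x^k-D^{-1}u^k)\big),\\ u^{k+1}&=P_W\eta^{k+1},\\ w^{k+1}&=J_{\tau A}\big(x^k+\tau y^k-\tau P_V(L^*u^{k+1}+Cx^k)\big),\\ r^{k+1}&=P_Vw^{k+1},\\ x^{k+1}&=P_VTr^{k+1},\\ y^{k+1}&=y^k+(r^{k+1}-w^{k+1})/\tau,\\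 \overline x^{k+1}&=x^{k+1}+r^{k+1}-x^k, \end{aligned}$$ where $J_M=(\mathrm{Id}+M)^{-1}$ denotes the resolvent of a set-valued operator $M$. Then there is a solution $(\widehat x,\widehat u)$ of $(\mathcal I)$ such that $\big((x^k,u^k)\big)_{k\in\mathbb N}$ converges weakly to $(\widehat x,\widehat u)$ in $\mathcal H\times\mathcal G$. -/

import Mathlib

open Filter Topology
open scoped ENNReal Pointwise RealInnerProductSpace

namespace PartialInverse

section Operators

variable {E : Type*} [NormedAddCommGroup E] [InnerProductSpace ℝ E]

/-- The graph of a set-valued operator. -/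
def gra (A : E → Set E) : Set (E × E) := {p | p.2 ∈ A p.1}

/-- The inverse of a set-valued operator: `x ∈ A⁻¹ u` iff `u ∈ A x`. -/
def invOp (A : E → Set E) : E → Set E := fun u => {x | u ∈ A x}

/-- The resolvent `J_A = (Id + A)⁻¹`, as a set-valued operator. -/
def resolventOp (A : E → Set E) : E → Set E := invOp (fun x => {x} + A x)

/-- `ρ`-strong monotonicity, for `ρ ∈ [0, +∞]`. The inequality is read in the extended reals with
`+∞ * 0 = 0`, so that `ρ = +∞` means that the domain of `A` has at most one point. -/
def IsStronglyMonotone (ρ : ℝ≥0∞) (A : E → Set E) : Prop :=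
  ∀ p ∈ gra A, ∀ q ∈ gra A,
    (ρ : EReal) * ((‖p.1 - q.1‖ ^ 2 : ℝ) : EReal) ≤ ((⟪p.1 - q.1, p.2 - q.2⟫ : ℝ) : EReal)

/-- Monotonicity of a set-valued operator. -/
def IsMonotone (A : E → Set E) : Prop :=
  ∀ p ∈ gra A, ∀ q ∈ gra A, 0 ≤ ⟪p.1 - q.1, p.2 - q.2⟫

/-- Maximal monotonicity: monotone, and the graph is not properly contained in the graph of
another monotone operator. -/
def IsMaximallyMonotone (A : E → Set E) : Prop :=
  IsMonotone A ∧ ¬ ∃ B : E → Set E, IsMonotone B ∧ gra A ⊂ gra B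

/-- `T` is `α`-averaged nonexpansive (used for `α ∈ ]0,1[`). -/
def IsAveragedNonexpansive (α : ℝ) (T : E → E) : Prop :=
  ∀ x y, ‖T x - T y‖ ^ 2 ≤ ‖x - y‖ ^ 2 - (1 - α) / α * ‖(x - T x) - (y - T y)‖ ^ 2

/-- `β`-cocoercivity, for `β ∈ ]0, +∞]`. The inequality is read in the extended reals with
`+∞ * 0 = 0`, so that `β = +∞` means that `C` is constant. -/
def IsCocoercive (β : ℝ≥0∞) (C : E → E) : Prop :=
  ∀ x y, (β : EReal) * ((‖C x - C y‖ ^ 2 : ℝ) : EReal) ≤ ((⟪x - y, C x - C y⟫ : ℝ) : EReal)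

/-- The normal cone `N_S` to a set `S`; it is empty at points outside `S`. -/
def normalCone (S : Set E) : E → Set E := fun x => {v | x ∈ S ∧ ∀ y ∈ S, ⟪y - x, v⟫ ≤ 0}

end Operators

section Problem

variable {H G : Type*} [NormedAddCommGroup H] [InnerProductSpace ℝ H] [CompleteSpace H]
  [NormedAddCommGroup G] [InnerProductSpace ℝ G] [CompleteSpace G]

/-- `(x, u) ∈ (V ∩ Fix T) × W` solves the primal-dual inclusion
`0 ∈ A x + C x + L* u + N_V x`, `0 ∈ B⁻¹ u + D⁻¹ u - L x`. -/
def IsSolution (V : ClosedSubmodule ℝ H) (W : ClosedSubmodule ℝ G) (T : H → H) (L : H →L[ℝ] G)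
    (A : H → Set H) (B D : G → Set G) (C : H → H) (x : H) (u : G) : Prop :=
  x ∈ (V : Set H) ∩ Function.fixedPoints T ∧ u ∈ W ∧
    0 ∈ A x + {C x} + {ContinuousLinearMap.adjoint L u} + normalCone (V : Set H) x ∧
    0 ∈ invOp B u + invOp D u - {L x}

/-- The sequences `x, x̄, y, u, η, w, r` are generated by the primal-dual partial inverse
splitting with step sizes `τ, γ`. The terms `η 0`, `w 0`, `r 0` play no role. The resolvents
and `D⁻¹` are set-valued operators, whose values are singletons under the hypotheses of the
convergence theorem; `d k` is the value of `D⁻¹` at `u k`. -/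
structure IsGenerated (V : ClosedSubmodule ℝ H)
    (W : ClosedSubmodule ℝ G) (T : H → H) (L : H →L[ℝ] G)
    (A : H → Set H) (B D : G → Set G) (C : H → H) (τ γ : ℝ)
    (x xbar y : ℕ → H) (u η : ℕ → G) (w r : ℕ → H) : Prop where
  x_zero : x 0 ∈ V
  xbar_zero : xbar 0 = x 0
  y_zero : y 0 ∈ V.toSubmoduleᗮ
  η_succ : ∀ k, ∃ d ∈ invOp D (u k),
    η (k + 1) ∈ resolventOp (γ • invOp B) (u k + γ • (L (xbar k) - d))
  u_succ : ∀ k, u (k + 1) = W.toSubmodule.starProjection (η (k + 1))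
  w_succ : ∀ k, w (k + 1) ∈ resolventOp (τ • A)
    (x k + τ • y k -
      τ • V.toSubmodule.starProjection (ContinuousLinearMap.adjoint L (u (k + 1)) + C (x k)))
  r_succ : ∀ k, r (k + 1) = V.toSubmodule.starProjection (w (k + 1))
  x_succ : ∀ k, x (k + 1) = V.toSubmodule.starProjection (T (r (k + 1)))
  y_succ : ∀ k, y (k + 1) = y k + τ⁻¹ • (r (k + 1) - w (k + 1))
  xbar_succ : ∀ k, xbar (k + 1) = x (k + 1) + r (k + 1) - x k

end Problem

end PartialInverse

/-! The proof is a Lyapunov argument followed by Opial's. Put `e k` for the last increment r - x, so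
that the extrapolated point is x + e. A solution corresponds to a point (x, y, u, d) with y ∈ Vᗮ and
d ∈ D⁻¹u satisfying one inclusion in A and one in B. Each iteration satisfies the same two
inclusions up to increments, since w = r + τ(y - y') splits along V and Vᗮ (the partial inverse).

Testing both inclusions against a solution and adding the averagedness of T shows that `energy`
decreases by a sum of squared residuals (`IsOrbit.energy_succ_le`). The bound on ‖L‖ makes the
quadratic form in (e, u) coercive, so the iterates are bounded and the residuals vanish
(`IsOrbit.hasVanishingResiduals`). As the bound is strict, C and D may be used with moduli slightly
below what is available; the surplus makes C x and d converge strongly.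

Bounded sequences converge weakly along every ultrafilter. In the sum of the A- and B-pairings the
weak-weak products ⟪u, L x⟫ cancel, so the sum passes to the limit and maximality identifies the
limit as a solution (`IsOrbit.isKTPoint_of_weakTendsto`). Since the weighted distance to each
solution converges, all these limits coincide (`IsOrbit.exists_isKTPoint_weakTendsto`). -/

namespace PartialInverse

/-! ### Weak convergence along filters -/

section Weak

variable {E F ι : Type*} [NormedAddCommGroup E] [InnerProductSpace ℝ E]
  [NormedAddCommGroup F] [InnerProductSpace ℝ F]

/-- Weak convergence of a family of vectors along a filter, tested against inner products. -/
def WeakTendsto (x : ι → E) (l : Filter ι) (a : E) : Prop :=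
  ∀ h, Tendsto (fun k => ⟪x k, h⟫) l (𝓝 ⟪a, h⟫)

theorem WeakTendsto.add {x y : ι → E} {l : Filter ι} {a b : E} (hx : WeakTendsto x l a)
    (hy : WeakTendsto y l b) : WeakTendsto (fun k => x k + y k) l (a + b) := fun h => by
  simpa only [inner_add_left] using (hx h).add (hy h)

theorem WeakTendsto.sub {x y : ι → E} {l : Filter ι} {a b : E} (hx : WeakTendsto x l a)
    (hy : WeakTendsto y l b) : WeakTendsto (fun k => x k - y k) l (a - b) := fun h => by
  simpa only [inner_sub_left] using (hx h).sub (hy h)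

theorem WeakTendsto.of_tendsto {x : ι → E} {l : Filter ι} {a : E} (hx : Tendsto x l (𝓝 a)) :
    WeakTendsto x l a := fun _ => hx.inner tendsto_const_nhds

theorem WeakTendsto.add_zero {x y : ι → E} {l : Filter ι} {a : E} (hx : WeakTendsto x l a)
    (hy : Tendsto y l (𝓝 0)) : WeakTendsto (fun k => x k + y k) l a := by
  simpa only [_root_.add_zero] using hx.add (.of_tendsto hy)

theorem WeakTendsto.map [CompleteSpace E] [CompleteSpace F] {x : ι → E} {l : Filter ι} {a : E}
    (hx : WeakTendsto x l a) (L : E →L[ℝ] F) : WeakTendsto (fun k => L (x k)) l (L a) := fun h => by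
  simpa only [ContinuousLinearMap.adjoint_inner_right] using hx (ContinuousLinearMap.adjoint L h)

theorem tendsto_inner_zero_of_bounded {x y : ι → E} {l : Filter ι} {M : ℝ} (hM : ∀ k, ‖x k‖ ≤ M)
    (hy : Tendsto y l (𝓝 0)) : Tendsto (fun k => ⟪x k, y k⟫) l (𝓝 0) := by
  refine squeeze_zero_norm (a := fun k => M * ‖y k‖) (fun k => ?_) ?_
  · exact (norm_inner_le_norm _ _).trans (mul_le_mul_of_nonneg_right (hM k) (norm_nonneg _))
  · simpa using (tendsto_zero_iff_norm_tendsto_zero.1 hy).const_mul M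

/-- The bound is a separate hypothesis because weak convergence along a general filter does not
imply boundedness. -/
theorem WeakTendsto.inner_tendsto {x y : ι → E} {l : Filter ι} {a b : E} {M : ℝ}
    (hx : WeakTendsto x l a) (hM : ∀ k, ‖x k‖ ≤ M) (hy : Tendsto y l (𝓝 b)) :
    Tendsto (fun k => ⟪x k, y k⟫) l (𝓝 ⟪a, b⟫) := by
  have h : Tendsto (fun k => y k - b) l (𝓝 0) := by simpa using hy.sub_const b
  have := (hx b).add (tendsto_inner_zero_of_bounded hM h)
  simpa only [← inner_add_right, add_sub_cancel, _root_.add_zero] using this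

/-- Banach-Alaoglu through the Riesz identification. With ultrafilters several bounded sequences
converge at once, without extracting common subsequences. -/
theorem exists_weakTendsto_ultrafilter [CompleteSpace E] (𝒰 : Ultrafilter ι) {x : ι → E} {M : ℝ}
    (hM : ∀ k, ‖x k‖ ≤ M) : ∃ a, WeakTendsto x 𝒰 a := by
  let g : ι → WeakDual ℝ E := fun k => StrongDual.toWeakDual (InnerProductSpace.toDual ℝ E (x k))
  have hc := WeakDual.isCompact_closedBall (𝕜 := ℝ) (E := E) 0 M
  obtain ⟨f, -, hf⟩ := hc.ultrafilter_le_nhds (𝒰.map g) (by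
    rw [le_principal_iff]
    refine Filter.mem_map.2 (Filter.univ_mem' fun k => ?_)
    simpa [g] using hM k)
  refine ⟨(InnerProductSpace.toDual ℝ E).symm (WeakDual.toStrongDual f), fun h => ?_⟩
  have h1 : Tendsto g 𝒰 (𝓝 f) := hf
  have h2 := (WeakDual.eval_continuous (𝕜 := ℝ) h).continuousAt.tendsto.comp h1
  rw [InnerProductSpace.toDual_symm_apply]
  exact h2

theorem WeakTendsto.mem [CompleteSpace E] {V : Submodule ℝ E} [V.HasOrthogonalProjection]
    {x : ι → E} {l : Filter ι} [l.NeBot] {a : E} (hx : WeakTendsto x l a) (hV : ∀ k, x k ∈ V) :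
    a ∈ V := by
  rw [← V.orthogonal_orthogonal, Submodule.mem_orthogonal']
  intro h hh
  refine tendsto_nhds_unique (hx h) ?_
  simp [fun k => Submodule.inner_right_of_mem_orthogonal (hV k) hh]

/-- Demiclosedness of `Id - T` at zero for a nonexpansive `T`. -/
theorem WeakTendsto.isFixedPt {T : E → E} (hT : ∀ x y, ‖T x - T y‖ ≤ ‖x - y‖) {x : ι → E}
    {l : Filter ι} [l.NeBot] {a : E} {M : ℝ} (hx : WeakTendsto x l a) (hM : ∀ k, ‖x k‖ ≤ M)
    (hTx : Tendsto (fun k => x k - T (x k)) l (𝓝 0)) : T a = a := by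
  -- With q denoting this sequence, T x - T a = (x - a) + q, so nonexpansiveness reads ‖q‖² + 2⟪x -
  -- a, q⟫ ≤ 0. As q converges strongly, the inner product tends to 0 and ‖a - T a‖² ≤ 0 remains.
  have hq : Tendsto (fun k => (a - T a) - (x k - T (x k))) l (𝓝 (a - T a)) := by
    simpa using hTx.const_sub (a - T a)
  have h1 := (hx.inner_tendsto hM hq).sub
    ((tendsto_const_nhds (x := a)).inner hq)
  have h2 := (hq.norm.pow 2).add (h1.const_mul 2)
  have h3 : ‖a - T a‖ ^ 2 + 2 * (⟪a, a - T a⟫ - ⟪a, a - T a⟫) ≤ 0 := by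
    refine le_of_tendsto h2 (Eventually.of_forall fun k => ?_)
    have h4 : ‖T (x k) - T a‖ ^ 2 ≤ ‖x k - a‖ ^ 2 := by gcongr; exact hT _ _
    have h5 : T (x k) - T a = (x k - a) + ((a - T a) - (x k - T (x k))) := by abel
    rw [h5, norm_add_sq_real, inner_sub_left] at h4
    linarith
  have h6 : ‖a - T a‖ ^ 2 = 0 := le_antisymm (by linarith) (by positivity)
  exact (sub_eq_zero.1 (by simpa using h6)).symm

/-- The product carries the sup norm and is not a Hilbert space, so Riesz is applied to the two
restrictions of a functional. -/
theorem tendsto_toWeakSpace_prod [CompleteSpace E] [CompleteSpace F] {x : ι → E} {u : ι → F}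
    {l : Filter ι} {a : E} {b : F} (hx : WeakTendsto x l a) (hu : WeakTendsto u l b) :
    Tendsto (fun k => toWeakSpace ℝ (E × F) (x k, u k)) l (𝓝 (toWeakSpace ℝ (E × F) (a, b))) := by
  refine (WeakBilin.tendsto_iff_forall_eval_tendsto (topDualPairing ℝ (E × F)).flip ?_).2 fun f => ?_
  · intro p q hpq
    by_contra hne
    obtain ⟨f, hf⟩ := SeparatingDual.exists_separating_of_ne (R := ℝ) hne
    exact hf (congrArg (fun φ => φ f) hpq)
  · have key : ∀ (p : E) (q : F), f (p, q) =
        ⟪p, (InnerProductSpace.toDual ℝ E).symm (f.comp (ContinuousLinearMap.inl ℝ E F))⟫ +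
        ⟪q, (InnerProductSpace.toDual ℝ F).symm (f.comp (ContinuousLinearMap.inr ℝ E F))⟫ := by
      intro p q
      rw [real_inner_comm, InnerProductSpace.toDual_symm_apply, real_inner_comm,
        InnerProductSpace.toDual_symm_apply]
      simp [← map_add]
    have := (hx ((InnerProductSpace.toDual ℝ E).symm (f.comp (ContinuousLinearMap.inl ℝ E F)))).add
      (hu ((InnerProductSpace.toDual ℝ F).symm (f.comp (ContinuousLinearMap.inr ℝ E F))))
    simp only [← key] at this
    exact this

end Weak

/-! ### Monotone operators, resolvents and normal cones -/

section Operators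

variable {E : Type*} [NormedAddCommGroup E] [InnerProductSpace ℝ E]

theorem IsMaximallyMonotone.mem_of_forall {A : E → Set E} (hA : IsMaximallyMonotone A) {x a : E}
    (h : ∀ z, ∀ b ∈ A z, 0 ≤ ⟪x - z, a - b⟫) : a ∈ A x := by
  by_contra hna
  refine hA.2 ⟨fun z => A z ∪ {b | z = x ∧ b = a}, ?_, ?_⟩
  · rintro ⟨p, p'⟩ hp ⟨q, q'⟩ hq
    simp only [gra, Set.mem_ofPred_eq, Set.mem_union] at hp hq
    rcases hp with hp | ⟨rfl, rfl⟩ <;> rcases hq with hq | ⟨rfl, rfl⟩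
    · exact hA.1 (p, p') hp (q, q') hq
    · have := h p p' hp
      rw [← neg_sub p, ← neg_sub p', inner_neg_neg] at this
      exact this
    · exact h q q' hq
    · simp
  · refine ⟨fun p hp => Or.inl hp, fun hs => hna ?_⟩
    exact hs (show (x, a) ∈ _ from Or.inr ⟨rfl, rfl⟩)

/-- Joint maximality of a pair of maximally monotone operators. -/
theorem IsMaximallyMonotone.mem_and_mem_of_forall {F : Type*} [NormedAddCommGroup F]
    [InnerProductSpace ℝ F] {A : E → Set E} {B : F → Set F} (hA : IsMaximallyMonotone A)
    (hB : IsMaximallyMonotone B) {x a : E} {u b : F}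
    (h : ∀ z, ∀ z' ∈ A z, ∀ v, ∀ v' ∈ B v, 0 ≤ ⟪x - z, a - z'⟫ + ⟪u - v, b - v'⟫) :
    a ∈ A x ∧ b ∈ B u := by
  have hAx : a ∈ A x := by
    by_contra hna
    obtain ⟨z, z', hz, hlt⟩ : ∃ z, ∃ z' ∈ A z, ⟪x - z, a - z'⟫ < 0 := by
      by_contra! hcon
      exact hna (hA.mem_of_forall hcon)
    refine hna ?_
    -- A negative A-pairing forces every B-pairing to be nonnegative, hence b ∈ B u. Testing with
    -- (u, b) itself then contradicts that negative value.
    have hBu : b ∈ B u := hB.mem_of_forall fun v v' hv => by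
      have := h z z' hz v v' hv
      linarith
    have := h z z' hz u b hBu
    simp at this
    linarith
  exact ⟨hAx, hB.mem_of_forall fun v v' hv => by simpa using h x a hAx v v' hv⟩

theorem real_mul_le_of_ereal_mul_le {ρ : ℝ≥0∞} {s q p : ℝ} (hs : ENNReal.ofReal s ≤ ρ)
    (hs0 : 0 ≤ s) (hq : 0 ≤ q) (h : (ρ : EReal) * (q : EReal) ≤ (p : EReal)) : s * q ≤ p := by
  have h1 : (s : EReal) ≤ (ρ : EReal) := by
    have : ((ENNReal.ofReal s : ℝ≥0∞) : EReal) ≤ (ρ : EReal) :=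
      EReal.coe_ennreal_le_coe_ennreal_iff.2 hs
    rwa [EReal.coe_ennreal_ofReal, max_eq_left hs0] at this
  have h2 : (s : EReal) * (q : EReal) ≤ (p : EReal) :=
    (mul_le_mul_of_nonneg_right h1 (EReal.coe_nonneg.2 hq)).trans h
  exact_mod_cast h2

theorem mem_resolventOp_smul {A : E → Set E} {c : ℝ} {p q : E}
    (h : p ∈ resolventOp (c • A) q) : ∃ a ∈ A p, p + c • a = q := by
  obtain ⟨p', hp', b, hb, hq⟩ := Set.mem_add.1 (show q ∈ {p} + (c • A) p from h)
  obtain ⟨a, ha, rfl⟩ := Set.mem_smul_set.1 (show b ∈ c • A p from hb)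
  rw [Set.mem_singleton_iff] at hp'
  exact ⟨a, ha, hp' ▸ hq⟩

theorem mem_normalCone_submodule {V : Submodule ℝ E} {x v : E} :
    v ∈ normalCone (V : Set E) x ↔ x ∈ V ∧ v ∈ Vᗮ := by
  refine and_congr_right fun hx => ⟨fun h => ?_, fun hv y hy => ?_⟩
  · rw [Submodule.mem_orthogonal]
    intro y hy
    have h1 := h (x + y) (V.add_mem hx hy)
    have h2 := h (x - y) (V.sub_mem hx hy)
    rw [add_sub_cancel_left] at h1
    rw [sub_sub_cancel_left, inner_neg_left] at h2
    linarith
  · exact (Submodule.inner_right_of_mem_orthogonal (V.sub_mem hy hx) hv).le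

end Operators

/-! ### Finite moduli and slack in the step-size condition -/

section Scalars

theorem exists_slack {l p q : ℝ} (hp : 0 < p) (hq : 0 < q) (h : l < p * q) :
    ∃ ε > 0, ε < p ∧ ε < q ∧ l < (p - ε) * (q - ε) := by
  have hc : ContinuousAt (fun ε : ℝ => (p - ε) * (q - ε)) 0 := by fun_prop
  have h1 : ∀ᶠ ε in 𝓝[>] (0 : ℝ), l < (p - ε) * (q - ε) :=
    (hc.tendsto.mono_left nhdsWithin_le_nhds).eventually_const_lt (by simpa using h)
  have h2 : ∀ᶠ ε in 𝓝[>] (0 : ℝ), ε < p := eventually_nhdsWithin_of_eventually_nhds (gt_mem_nhds hp)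
  have h3 : ∀ᶠ ε in 𝓝[>] (0 : ℝ), ε < q := eventually_nhdsWithin_of_eventually_nhds (gt_mem_nhds hq)
  obtain ⟨ε, h1, h2, h3, h4⟩ := (h1.and (h2.and (h3.and self_mem_nhdsWithin))).exists
  exact ⟨ε, h4, h2, h3, h1⟩

theorem toReal_one_div_lt {ρ : ℝ≥0∞} {τ : ℝ} (hτ : 0 < τ) (h : ENNReal.ofReal τ < 2 * ρ) :
    0 < 1 / τ - (1 / (2 * ρ)).toReal := by
  induction ρ with
  | top => simpa using hτ
  | coe b =>
    have h' : τ < 2 * (b : ℝ) := by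
      have h2 : (2 : ℝ≥0∞) * b = ENNReal.ofReal (2 * (b : ℝ)) := by
        rw [ENNReal.ofReal_mul (by norm_num)]; simp
      rw [h2] at h
      exact (ENNReal.ofReal_lt_ofReal_iff_of_nonneg hτ.le).1 h
    have : (1 / (2 * (b : ℝ≥0∞))).toReal = 1 / (2 * (b : ℝ)) := by simp
    rw [this, sub_pos]
    exact one_div_lt_one_div_of_lt hτ h'

theorem exists_moduli {ρ : ℝ≥0∞} (hρ : 0 < ρ) {ε : ℝ} (hε : 0 < ε) :
    ∃ s s' : ℝ, 0 < s ∧ s < s' ∧ ENNReal.ofReal s' ≤ ρ ∧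
      1 / (2 * s) = (1 / (2 * ρ)).toReal + ε := by
  have hκ : 0 ≤ (1 / (2 * ρ)).toReal := ENNReal.toReal_nonneg
  -- Enlarging 1/(2ρ) by ε, respectively ε/2, gives finite moduli even when ρ = ∞.
  refine ⟨1 / (2 * ((1 / (2 * ρ)).toReal + ε)), 1 / (2 * ((1 / (2 * ρ)).toReal + ε / 2)),
    by positivity, ?_, ?_, ?_⟩
  · apply one_div_lt_one_div_of_lt <;> linarith
  · induction ρ with
    | top => exact le_top
    | coe b =>
      have hb : 0 < (b : ℝ) := by exact_mod_cast hρ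
      have : (1 / (2 * (b : ℝ≥0∞))).toReal = 1 / (2 * (b : ℝ)) := by simp
      rw [this]
      refine ENNReal.ofReal_le_of_le_toReal ?_
      rw [ENNReal.coe_toReal, div_le_iff₀ (by positivity)]
      have : (b : ℝ) * (2 * (1 / (2 * b) + ε / 2)) = 1 + b * ε := by field_simp
      rw [this]
      nlinarith
  · field_simp

end Scalars

/-! ### Polarization identities -/

section Polarization

variable {E : Type*} [NormedAddCommGroup E] [InnerProductSpace ℝ E]

theorem two_mul_inner_sub_sub (a b c : E) :
    2 * ⟪a - c, b - a⟫ = ‖b - c‖ ^ 2 - ‖b - a‖ ^ 2 - ‖a - c‖ ^ 2 := by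
  have : b - c = (b - a) + (a - c) := by abel
  rw [this, norm_add_sq_real, real_inner_comm]
  ring

/-- Expansion of ‖a + 2s b‖² ≥ 0. This pays for evaluating C and D⁻¹ at the old iterate, and is the
source of the terms 1/(2s) and 1/(2t). -/
theorem neg_norm_sq_le_inner_add {s : ℝ} (hs : 0 < s) (a b : E) :
    -(1 / (2 * s) * ‖a‖ ^ 2) ≤ 2 * ⟪a, b⟫ + 2 * s * ‖b‖ ^ 2 := by
  have h : 0 ≤ 1 / (2 * s) * ‖a + (2 * s) • b‖ ^ 2 := by positivity
  rw [norm_add_sq_real, inner_smul_right, norm_smul, Real.norm_of_nonneg (by positivity)] at h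
  have : 1 / (2 * s) * (‖a‖ ^ 2 + 2 * (2 * s * ⟪a, b⟫) + (2 * s * ‖b‖) ^ 2) =
      1 / (2 * s) * ‖a‖ ^ 2 + (2 * ⟪a, b⟫ + 2 * s * ‖b‖ ^ 2) := by
    field_simp
    ring
  linarith

/-- Orthogonality of V and Vᗮ removes the cross terms, leaving one three-point identity in V and one
in Vᗮ. -/
theorem inner_partialInverse {V : Submodule ℝ E} [V.HasOrthogonalProjection] {τ : ℝ}
    {x r x₀ y y' y₀ : E} (hx : x ∈ V) (hr : r ∈ V) (hx₀ : x₀ ∈ V) (hy : y ∈ Vᗮ) (hy' : y' ∈ Vᗮ)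
    (hy₀ : y₀ ∈ Vᗮ) (p q : E) :
    2 * ⟪r + τ • (y - y') - x₀, τ⁻¹ • (x - r) + y' - V.starProjection p -
        (y₀ - V.starProjection q)⟫ =
      τ⁻¹ * (‖x - x₀‖ ^ 2 - ‖x - r‖ ^ 2 - ‖r - x₀‖ ^ 2) +
        τ * (‖y - y₀‖ ^ 2 - ‖y - y'‖ ^ 2 - ‖y' - y₀‖ ^ 2) - 2 * ⟪r - x₀, p - q⟫ := by
  have h1 : r + τ • (y - y') - x₀ = (r - x₀) + τ • (y - y') := by abel
  have h2 : τ⁻¹ • (x - r) + y' - V.starProjection p - (y₀ - V.starProjection q) =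
      (τ⁻¹ • (x - r) - V.starProjection (p - q)) + (y' - y₀) := by
    rw [map_sub]; abel
  have hrV : r - x₀ ∈ V := V.sub_mem hr hx₀
  have hyV : τ • (y - y') ∈ Vᗮ := Vᗮ.smul_mem _ (Vᗮ.sub_mem hy hy')
  have h3 : ⟪r - x₀, y' - y₀⟫ = 0 :=
    Submodule.inner_right_of_mem_orthogonal hrV (Vᗮ.sub_mem hy' hy₀)
  have h4 : ⟪τ • (y - y'), τ⁻¹ • (x - r) - V.starProjection (p - q)⟫ = 0 :=
    Submodule.inner_left_of_mem_orthogonal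
      (V.sub_mem (V.smul_mem _ (V.sub_mem hx hr)) (V.starProjection_apply_mem _)) hyV
  have h5 : ⟪r - x₀, V.starProjection (p - q)⟫ = ⟪r - x₀, p - q⟫ := by
    rw [← Submodule.inner_starProjection_left_eq_right, Submodule.starProjection_eq_self_iff.2 hrV]
  rw [h1, h2, inner_add_left, inner_add_right, inner_add_right, h3, h4, inner_sub_right, h5,
    inner_smul_right, inner_smul_left, RCLike.conj_to_real]
  have h6 := two_mul_inner_sub_sub r x x₀
  have h7 := two_mul_inner_sub_sub y' y y₀
  have h8 : ⟪y - y', y' - y₀⟫ = ⟪y' - y₀, y - y'⟫ := real_inner_comm _ _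
  rw [h8]
  linear_combination τ⁻¹ * h6 + τ * h7

end Polarization

/-! ### The Lyapunov inequality -/

section Iteration

variable {H G : Type*} [NormedAddCommGroup H] [InnerProductSpace ℝ H] [CompleteSpace H]
  [NormedAddCommGroup G] [InnerProductSpace ℝ G] [CompleteSpace G]

/-- A primal-dual solution `(x, u)` together with the element `y` of `Vᗮ` and the value `d` of
`D⁻¹` at `u` that certify it. -/
structure IsKTPoint (V : Submodule ℝ H) [V.HasOrthogonalProjection] (W : Submodule ℝ G)
    (T : H → H) (L : H →L[ℝ] G) (A : H → Set H) (B D : G → Set G) (C : H → H)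
    (x y : H) (u d : G) : Prop where
  x_mem : x ∈ V
  fixed : T x = x
  y_mem : y ∈ Vᗮ
  u_mem : u ∈ W
  d_mem : u ∈ D d
  primal : y - V.starProjection (ContinuousLinearMap.adjoint L u + C x) ∈ A x
  dual : u ∈ B (L x - d)

/-- The algorithm in terms of graph inclusions: `e k` is the increment `r^k - x^{k-1}`, while
`η k` and `r k` are the intermediate points that produce the iterate of index `k + 1`. -/
structure IsOrbit (V : Submodule ℝ H) [V.HasOrthogonalProjection] (W : Submodule ℝ G)
    [W.HasOrthogonalProjection] (T : H → H) (L : H →L[ℝ] G) (A : H → Set H) (B D : G → Set G)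
    (C : H → H) (τ γ : ℝ) (x y : ℕ → H) (u d η : ℕ → G) (r e : ℕ → H) : Prop where
  x_mem : ∀ k, x k ∈ V
  y_mem : ∀ k, y k ∈ Vᗮ
  u_mem : ∀ k, u k ∈ W
  r_mem : ∀ k, r k ∈ V
  d_mem : ∀ k, u k ∈ D (d k)
  dual : ∀ k, η k ∈ B (γ⁻¹ • (u k - η k) + L (x k + e k) - d k)
  u_succ : ∀ k, u (k + 1) = W.starProjection (η k)
  primal : ∀ k, τ⁻¹ • (x k - r k) + y (k + 1) -
    V.starProjection (ContinuousLinearMap.adjoint L (u (k + 1)) + C (x k)) ∈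
      A (r k + τ • (y k - y (k + 1)))
  x_succ : ∀ k, x (k + 1) = V.starProjection (T (r k))
  e_succ : ∀ k, e (k + 1) = r k - x k

/-- The Lyapunov function of the algorithm with respect to the reference point
`(x₀, y₀, u₀)`. -/
noncomputable def energy (L : H →L[ℝ] G) (τ γ μ : ℝ) (x₀ y₀ : H) (u₀ : G) (x y : H) (u : G)
    (e : H) : ℝ :=
  τ⁻¹ * ‖x - x₀‖ ^ 2 + γ⁻¹ * ‖u - u₀‖ ^ 2 + τ * ‖y - y₀‖ ^ 2 + μ * ‖e‖ ^ 2 + 2 * ⟪u - u₀, L e⟫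

variable {V : Submodule ℝ H} [V.HasOrthogonalProjection] {W : Submodule ℝ G}
  [W.HasOrthogonalProjection] {T : H → H} {L : H →L[ℝ] G} {A : H → Set H} {B D : G → Set G}
  {C : H → H} {τ γ : ℝ} {x y : ℕ → H} {u d η : ℕ → G} {r e : ℕ → H}

/-- The sum of the monotonicity of A and B, the estimates for C and D, and the averagedness of T at
the reference point. Using s, t instead of s', t' in the Young estimates leaves the last two
squares. -/
theorem IsOrbit.energy_succ_le (h : IsOrbit V W T L A B D C τ γ x y u d η r e)
    {x₀ y₀ : H} {u₀ d₀ : G} (h₀ : IsKTPoint V W T L A B D C x₀ y₀ u₀ d₀)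
    {α s s' t t' : ℝ} (hT : IsAveragedNonexpansive α T) (hL : ∀ z, L z ∈ W)
    (hA : IsMonotone A) (hB : IsMonotone B) (hτ : 0 < τ) (hs : 0 < s) (ht : 0 < t)
    (hC : ∀ p q, s' * ‖C p - C q‖ ^ 2 ≤ ⟪p - q, C p - C q⟫)
    (hD : ∀ p q, ∀ v ∈ D p, ∀ w ∈ D q, t' * ‖p - q‖ ^ 2 ≤ ⟪p - q, v - w⟫) (k : ℕ) :
    energy L τ γ (1 / τ - 1 / (2 * s)) x₀ y₀ u₀ (x (k + 1)) (y (k + 1)) (u (k + 1)) (e (k + 1)) +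
      ((1 / τ - 1 / (2 * s)) * ‖e k‖ ^ 2 + (1 / γ - 1 / (2 * t)) * ‖u (k + 1) - u k‖ ^ 2 -
        2 * ⟪u (k + 1) - u k, L (e k)⟫ +
        (1 / γ - 1 / (2 * t) + 1 / γ) * ‖η k - u (k + 1)‖ ^ 2 + τ * ‖y k - y (k + 1)‖ ^ 2 +
        τ⁻¹ * ((1 - α) / α * ‖r k - T (r k)‖ ^ 2) +
        2 * (s' - s) * ‖C (x k) - C x₀‖ ^ 2 + 2 * (t' - t) * ‖d k - d₀‖ ^ 2) ≤
      energy L τ γ (1 / τ - 1 / (2 * s)) x₀ y₀ u₀ (x k) (y k) (u k) (e k) := by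
  have hx₀ := h₀.x_mem
  -- primal inequality
  have hAm := hA (_, _) (h.primal k) (_, _) h₀.primal
  have hAe := inner_partialInverse (τ := τ) (h.x_mem k) (h.r_mem k) hx₀ (h.y_mem k) (h.y_mem (k + 1))
    h₀.y_mem (ContinuousLinearMap.adjoint L (u (k + 1)) + C (x k))
    (ContinuousLinearMap.adjoint L u₀ + C x₀)
  have hAs : ⟪r k - x₀, ContinuousLinearMap.adjoint L (u (k + 1)) + C (x k) -
      (ContinuousLinearMap.adjoint L u₀ + C x₀)⟫ =
      ⟪u (k + 1) - u₀, L (r k - x₀)⟫ + ⟪r k - x k, C (x k) - C x₀⟫ +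
        ⟪x k - x₀, C (x k) - C x₀⟫ := by
    rw [add_sub_add_comm, inner_add_right, ← map_sub, ContinuousLinearMap.adjoint_inner_right,
      real_inner_comm, add_assoc, ← inner_add_left, sub_add_sub_cancel]
  have hCc := hC (x k) x₀
  have hCy := neg_norm_sq_le_inner_add hs (r k - x k) (C (x k) - C x₀)
  -- dual inequality
  have hBm := hB (_, _) (h.dual k) (_, _) h₀.dual
  have hBs : ⟪γ⁻¹ • (u k - η k) + L (x k + e k) - d k - (L x₀ - d₀), η k - u₀⟫ =
      γ⁻¹ * ⟪η k - u₀, u k - η k⟫ + ⟪η k - u₀, L (x k + e k - x₀)⟫ - ⟪η k - u k, d k - d₀⟫ -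
        ⟪d k - d₀, u k - u₀⟫ := by
    have e1 : γ⁻¹ • (u k - η k) + L (x k + e k) - d k - (L x₀ - d₀) =
        γ⁻¹ • (u k - η k) + L (x k + e k - x₀) - (d k - d₀) := by
      rw [map_sub L (x k + e k)]; abel
    have e2 : ⟪η k - u₀, d k - d₀⟫ = ⟪η k - u k, d k - d₀⟫ + ⟪d k - d₀, u k - u₀⟫ := by
      rw [real_inner_comm (u k - u₀), ← inner_add_left, sub_add_sub_cancel]
    rw [e1, real_inner_comm, inner_sub_right, inner_add_right, inner_smul_right, e2]
    ring
  have hBp := two_mul_inner_sub_sub (η k) (u k) u₀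
  have hDc := hD (d k) d₀ _ (h.d_mem k) _ h₀.d_mem
  have hDy := neg_norm_sq_le_inner_add ht (η k - u k) (d k - d₀)
  -- Because the range of L lies in W, η may be replaced by its projection in every pairing with L,
  -- while the squared norms gain ‖η - u'‖² by Pythagoras.
  have hort : ∀ v ∈ W, ⟪η k - u (k + 1), v⟫ = 0 := fun v hv => by
    rw [h.u_succ]; exact Submodule.starProjection_inner_eq_zero _ _ hv
  have hW1 : ⟪η k - u₀, L (x k + e k - x₀)⟫ = ⟪u (k + 1) - u₀, L (x k + e k - x₀)⟫ := by
    rw [← sub_add_sub_cancel (η k) (u (k + 1)) u₀, inner_add_left, hort _ (hL _), zero_add]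
  have hW2 : ‖η k - u₀‖ ^ 2 = ‖η k - u (k + 1)‖ ^ 2 + ‖u (k + 1) - u₀‖ ^ 2 := by
    rw [← sub_add_sub_cancel (η k) (u (k + 1)) u₀, norm_add_sq_real,
      hort _ (W.sub_mem (h.u_mem _) h₀.u_mem)]
    ring
  have hW3 : ‖η k - u k‖ ^ 2 = ‖η k - u (k + 1)‖ ^ 2 + ‖u (k + 1) - u k‖ ^ 2 := by
    rw [← sub_add_sub_cancel (η k) (u (k + 1)) (u k), norm_add_sq_real,
      hort _ (W.sub_mem (h.u_mem _) (h.u_mem _))]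
    ring
  -- the coupling terms telescope
  have hcoup : ⟪u (k + 1) - u₀, L (x k + e k - x₀)⟫ - ⟪u (k + 1) - u₀, L (r k - x₀)⟫ =
      ⟪u k - u₀, L (e k)⟫ + ⟪u (k + 1) - u k, L (e k)⟫ - ⟪u (k + 1) - u₀, L (e (k + 1))⟫ := by
    rw [← inner_add_left, add_comm (u k - u₀), sub_add_sub_cancel, ← inner_sub_right,
      ← inner_sub_right, ← map_sub, ← map_sub, h.e_succ]
    congr 2; abel
  -- the fixed-point step
  have hTx : ‖x (k + 1) - x₀‖ ^ 2 ≤ ‖r k - x₀‖ ^ 2 - (1 - α) / α * ‖r k - T (r k)‖ ^ 2 := by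
    have e1 := hT (r k) x₀
    rw [h₀.fixed, sub_self, sub_zero] at e1
    refine le_trans ?_ e1
    have e2 : x (k + 1) - x₀ = V.starProjection (T (r k) - x₀) := by
      rw [map_sub, Submodule.starProjection_eq_self_iff.2 hx₀, h.x_succ]
    rw [e2]
    gcongr
    exact Submodule.norm_starProjection_apply_le _ _
  have hTx' := mul_le_mul_of_nonneg_left hTx (inv_nonneg.2 hτ.le)
  have en : ‖e (k + 1)‖ ^ 2 = ‖r k - x k‖ ^ 2 := by rw [h.e_succ]
  have en' : ‖x k - r k‖ ^ 2 = ‖r k - x k‖ ^ 2 := by rw [norm_sub_rev]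
  have en'' : ‖u k - η k‖ ^ 2 = ‖η k - u k‖ ^ 2 := by rw [norm_sub_rev]
  simp only at hAm hBm
  rw [hBs, hW1] at hBm
  rw [hAs, en'] at hAe
  rw [en'', hW3, hW2] at hBp
  rw [hW3] at hDy
  have hBp' : 2 * (γ⁻¹ * ⟪η k - u₀, u k - η k⟫) = γ⁻¹ * (‖u k - u₀‖ ^ 2 -
    (‖η k - u (k + 1)‖ ^ 2 + ‖u (k + 1) - u k‖ ^ 2) -
    (‖η k - u (k + 1)‖ ^ 2 + ‖u (k + 1) - u₀‖ ^ 2)) := by rw [← hBp]; ring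
  unfold energy
  rw [en, one_div τ, one_div γ]
  linarith

end Iteration

/-! ### Real sequences, boundedness and the coercive quadratic form -/

section Asymptotics

theorem exists_tendsto_of_add_le {Φ ρ : ℕ → ℝ} (hΦ : ∀ k, 0 ≤ Φ k) (hρ : ∀ k, 0 ≤ ρ k)
    (h : ∀ k, Φ (k + 1) + ρ k ≤ Φ k) :
    (∃ l, Tendsto Φ atTop (𝓝 l)) ∧ Tendsto ρ atTop (𝓝 0) := by
  have hanti : Antitone Φ := antitone_nat_of_succ_le fun k => by linarith [hρ k, h k]
  have hlim := tendsto_atTop_ciInf hanti ⟨0, by rintro _ ⟨k, rfl⟩; exact hΦ k⟩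
  refine ⟨⟨_, hlim⟩, squeeze_zero hρ (fun k => ?_) (g := fun k => Φ k - Φ (k + 1)) ?_⟩
  · linarith [h k]
  · simpa using hlim.sub (hlim.comp (tendsto_add_atTop_nat 1))

variable {E F ι : Type*} [NormedAddCommGroup E]

theorem tendsto_zero_of_mul_norm_sq_le {z : ι → E} {l : Filter ι} {ρ : ι → ℝ} {c : ℝ}
    (hc : 0 < c) (h : ∀ k, c * ‖z k‖ ^ 2 ≤ ρ k) (hρ : Tendsto ρ l (𝓝 0)) :
    Tendsto z l (𝓝 0) := by
  rw [tendsto_zero_iff_norm_tendsto_zero]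
  have h1 : Tendsto (fun k => ‖z k‖ ^ 2) l (𝓝 0) := by
    refine squeeze_zero (fun k => by positivity) (fun k => ?_) (g := fun k => ρ k / c) ?_
    · rw [le_div_iff₀ hc, mul_comm]; exact h k
    · simpa using hρ.div_const c
  simpa [Real.sqrt_sq] using h1.sqrt

theorem exists_norm_le_of_mul_norm_sub_sq_le {z : ι → E} {a : E} {c K : ℝ} (hc : 0 < c)
    (h : ∀ k, c * ‖z k - a‖ ^ 2 ≤ K) : ∃ M, ∀ k, ‖z k‖ ≤ M := by
  refine ⟨√(K / c) + ‖a‖, fun k => ?_⟩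
  have h1 : ‖z k - a‖ ≤ √(K / c) := Real.le_sqrt_of_sq_le (by
    rw [le_div_iff₀ hc, mul_comm]; exact h k)
  have h2 := norm_add_le (z k - a) a
  rw [sub_add_cancel] at h2
  linarith

theorem exists_norm_le_of_tendsto {z : ℕ → E} {a : E} (h : Tendsto z atTop (𝓝 a)) :
    ∃ M, ∀ k, ‖z k‖ ≤ M := by
  obtain ⟨M, hM⟩ := h.norm.bddAbove_range
  exact ⟨M, fun k => hM ⟨k, rfl⟩⟩

theorem exists_norm_le_add {x y : ι → E} (hx : ∃ M, ∀ k, ‖x k‖ ≤ M) (hy : ∃ M, ∀ k, ‖y k‖ ≤ M) :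
    ∃ M, ∀ k, ‖x k + y k‖ ≤ M := by
  obtain ⟨M, hM⟩ := hx
  obtain ⟨N, hN⟩ := hy
  exact ⟨M + N, fun k => (norm_add_le _ _).trans (add_le_add (hM k) (hN k))⟩

variable [InnerProductSpace ℝ E] [NormedAddCommGroup F] [InnerProductSpace ℝ F]

theorem norm_sub_sq_sub_norm_sub_sq (p q z : E) :
    ‖z - p‖ ^ 2 - ‖z - q‖ ^ 2 = ‖p‖ ^ 2 - ‖q‖ ^ 2 + 2 * ⟪z, q - p⟫ := by
  rw [norm_sub_sq_real, norm_sub_sq_real, inner_sub_right]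
  ring

/-- After Cauchy-Schwarz this is a binary quadratic form in (‖z‖, ‖v‖) with positive determinant;
strictness lets c be subtracted from both diagonal entries. -/
theorem exists_quadratic_lower_bound (L : E →L[ℝ] F) {μ ν : ℝ} (hμ : 0 < μ) (hν : 0 < ν)
    (h : ‖L‖ ^ 2 < μ * ν) :
    ∃ c > 0, ∀ (z : E) (v : F), c * ‖z‖ ^ 2 + c * ‖v‖ ^ 2 ≤
      μ * ‖z‖ ^ 2 + ν * ‖v‖ ^ 2 + 2 * ⟪v, L z⟫ := by
  obtain ⟨c, hc, hcμ, hcν, hlt⟩ := exists_slack hμ hν h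
  refine ⟨c, hc, fun z v => ?_⟩
  have h1 : -(‖v‖ * (‖L‖ * ‖z‖)) ≤ ⟪v, L z⟫ := by
    have := (abs_le.1 (abs_real_inner_le_norm v (L z))).1
    have := mul_le_mul_of_nonneg_left (L.le_opNorm z) (norm_nonneg v)
    linarith
  have hp : 0 < μ - c := sub_pos.2 hcμ
  have h2 : 0 ≤ (μ - c) * ((μ - c) * ‖z‖ ^ 2 + (ν - c) * ‖v‖ ^ 2 - 2 * (‖v‖ * (‖L‖ * ‖z‖))) := by
    have e1 : (μ - c) * ((μ - c) * ‖z‖ ^ 2 + (ν - c) * ‖v‖ ^ 2 - 2 * (‖v‖ * (‖L‖ * ‖z‖))) =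
        ((μ - c) * ‖z‖ - ‖L‖ * ‖v‖) ^ 2 + ((μ - c) * (ν - c) - ‖L‖ ^ 2) * ‖v‖ ^ 2 := by ring
    have : 0 ≤ (μ - c) * (ν - c) - ‖L‖ ^ 2 := by linarith
    rw [e1]
    positivity
  have h3 := nonneg_of_mul_nonneg_right h2 hp
  linarith

end Asymptotics

/-! ### Vanishing residuals, cluster points and Opial's argument -/

section Convergence

variable {H G : Type*} [NormedAddCommGroup H] [InnerProductSpace ℝ H] [CompleteSpace H]
  [NormedAddCommGroup G] [InnerProductSpace ℝ G] [CompleteSpace G]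

/-- The standing assumptions on the operators and the step sizes, with finite moduli
`s < s'` of cocoercivity of `C` and `t < t'` of strong monotonicity of `D`. -/
structure IsAdmissible (W : Submodule ℝ G) (T : H → H) (L : H →L[ℝ] G) (A : H → Set H)
    (B D : G → Set G) (C : H → H) (τ γ α s s' t t' : ℝ) : Prop where
  averaged : IsAveragedNonexpansive α T
  averaged_pos : 0 < (1 - α) / α
  map_mem : ∀ z, L z ∈ W
  maxA : IsMaximallyMonotone A
  maxB : IsMaximallyMonotone B
  maxD : IsMaximallyMonotone D
  τ_pos : 0 < τ
  γ_pos : 0 < γ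
  s_pos : 0 < s
  s_lt : s < s'
  t_pos : 0 < t
  t_lt : t < t'
  coco : ∀ p q, s' * ‖C p - C q‖ ^ 2 ≤ ⟪p - q, C p - C q⟫
  strong : ∀ p q, ∀ v ∈ D p, ∀ w ∈ D q, t' * ‖p - q‖ ^ 2 ≤ ⟪p - q, v - w⟫
  primal_pos : 0 < 1 / τ - 1 / (2 * s)
  dual_pos : 0 < 1 / γ - 1 / (2 * t)
  norm_sq_lt : ‖L‖ ^ 2 < (1 / τ - 1 / (2 * s)) * (1 / γ - 1 / (2 * t))

variable {V : Submodule ℝ H} [V.HasOrthogonalProjection] {W : Submodule ℝ G}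
  [W.HasOrthogonalProjection] {T : H → H} {L : H →L[ℝ] G} {A : H → Set H} {B D : G → Set G}
  {C : H → H} {τ γ : ℝ} {x y : ℕ → H} {u d η : ℕ → G} {r e : ℕ → H}

/-- Quantities produced by the Lyapunov analysis with respect to the solution
`(x₀, y₀, u₀, d₀)`. -/
structure HasVanishingResiduals (T : H → H) (C : H → H) (τ γ : ℝ) (x y : ℕ → H) (u d η : ℕ → G)
    (r e : ℕ → H) (x₀ y₀ : H) (u₀ d₀ : G) : Prop where
  dist : ∃ l, Tendsto (fun k => τ⁻¹ * ‖x k - x₀‖ ^ 2 + γ⁻¹ * ‖u k - u₀‖ ^ 2 + τ * ‖y k - y₀‖ ^ 2)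
    atTop (𝓝 l)
  bdd_x : ∃ M, ∀ k, ‖x k‖ ≤ M
  bdd_y : ∃ M, ∀ k, ‖y k‖ ≤ M
  bdd_u : ∃ M, ∀ k, ‖u k‖ ≤ M
  e_tendsto : Tendsto e atTop (𝓝 0)
  u_tendsto : Tendsto (fun k => u (k + 1) - u k) atTop (𝓝 0)
  η_tendsto : Tendsto (fun k => η k - u (k + 1)) atTop (𝓝 0)
  y_tendsto : Tendsto (fun k => y k - y (k + 1)) atTop (𝓝 0)
  r_tendsto : Tendsto (fun k => r k - T (r k)) atTop (𝓝 0)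
  C_tendsto : Tendsto (fun k => C (x k)) atTop (𝓝 (C x₀))
  d_tendsto : Tendsto d atTop (𝓝 d₀)

theorem IsOrbit.hasVanishingResiduals (h : IsOrbit V W T L A B D C τ γ x y u d η r e)
    {x₀ y₀ : H} {u₀ d₀ : G} (h₀ : IsKTPoint V W T L A B D C x₀ y₀ u₀ d₀)
    {α s s' t t' : ℝ} (hP : IsAdmissible W T L A B D C τ γ α s s' t t') :
    HasVanishingResiduals T C τ γ x y u d η r e x₀ y₀ u₀ d₀ := by
  obtain ⟨c, hc, hquad⟩ := exists_quadratic_lower_bound L hP.primal_pos hP.dual_pos hP.norm_sq_lt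
  have hstep := h.energy_succ_le h₀ hP.averaged hP.map_mem hP.maxA.1 hP.maxB.1 hP.τ_pos hP.s_pos
    hP.t_pos hP.coco hP.strong
  have hτ := hP.τ_pos
  have hτi : 0 < τ⁻¹ := inv_pos.2 hτ
  have hγi : 0 < γ⁻¹ := inv_pos.2 hP.γ_pos
  have hα := hP.averaged_pos
  have hs : 0 < s' - s := sub_pos.2 hP.s_lt
  have ht : 0 < t' - t := sub_pos.2 hP.t_lt
  have htt : 0 < 1 / (2 * t) := by have := hP.t_pos; positivity
  have hν := hP.dual_pos
  set μ := 1 / τ - 1 / (2 * s) with hμ_def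
  set Φ : ℕ → ℝ := fun k => energy L τ γ μ x₀ y₀ u₀ (x k) (y k) (u k) (e k) with hΦ_def
  have hη : 0 < 1 / γ - 1 / (2 * t) + 1 / γ := by rw [one_div γ] at hν ⊢; linarith
  set ρ : ℕ → ℝ := fun k => c * ‖e k‖ ^ 2 + c * ‖u (k + 1) - u k‖ ^ 2 +
    (1 / γ - 1 / (2 * t) + 1 / γ) * ‖η k - u (k + 1)‖ ^ 2 + τ * ‖y k - y (k + 1)‖ ^ 2 +
    (τ⁻¹ * ((1 - α) / α)) * ‖r k - T (r k)‖ ^ 2 +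
    (2 * (s' - s)) * ‖C (x k) - C x₀‖ ^ 2 + (2 * (t' - t)) * ‖d k - d₀‖ ^ 2 with hρ_def
  have hlow : ∀ k, τ⁻¹ * ‖x k - x₀‖ ^ 2 + τ * ‖y k - y₀‖ ^ 2 + c * ‖u k - u₀‖ ^ 2 ≤ Φ k := by
    intro k
    have h1 := hquad (e k) (u k - u₀)
    have h2 : 0 ≤ 1 / (2 * t) * ‖u k - u₀‖ ^ 2 := by positivity
    have h3 : 0 ≤ c * ‖e k‖ ^ 2 := by positivity
    simp only [hΦ_def, energy]
    rw [one_div γ] at h1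
    linarith
  have hΦ0 : ∀ k, 0 ≤ Φ k := fun k => le_trans (by positivity) (hlow k)
  have hρ0 : ∀ k, 0 ≤ ρ k := fun k => by simp only [hρ_def]; positivity
  have hdec : ∀ k, Φ (k + 1) + ρ k ≤ Φ k := by
    intro k
    -- The cross term has the opposite sign in the decrease, hence the negated increment.
    have h1 := hquad (e k) (-(u (k + 1) - u k))
    rw [inner_neg_left, norm_neg] at h1
    have h2 := hstep k
    simp only [hΦ_def, hρ_def]
    linarith
  obtain ⟨⟨l, hl⟩, hρ⟩ := exists_tendsto_of_add_le hΦ0 hρ0 hdec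
  have hle : ∀ k, Φ k ≤ Φ 0 := fun k =>
    (antitone_nat_of_succ_le fun k => by linarith [hρ0 k, hdec k]) (Nat.zero_le k)
  have n1 : ∀ k, 0 ≤ c * ‖e k‖ ^ 2 := fun k => by positivity
  have n2 : ∀ k, 0 ≤ c * ‖u (k + 1) - u k‖ ^ 2 := fun k => by positivity
  have n3 : ∀ k, 0 ≤ (1 / γ - 1 / (2 * t) + 1 / γ) * ‖η k - u (k + 1)‖ ^ 2 :=
    fun k => by positivity
  have n4 : ∀ k, 0 ≤ τ * ‖y k - y (k + 1)‖ ^ 2 := fun k => by positivity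
  have n5 : ∀ k, 0 ≤ (τ⁻¹ * ((1 - α) / α)) * ‖r k - T (r k)‖ ^ 2 := fun k => by positivity
  have n6 : ∀ k, 0 ≤ (2 * (s' - s)) * ‖C (x k) - C x₀‖ ^ 2 := fun k => by positivity
  have n7 : ∀ k, 0 ≤ (2 * (t' - t)) * ‖d k - d₀‖ ^ 2 := fun k => by positivity
  have m1 : ∀ k, 0 ≤ τ⁻¹ * ‖x k - x₀‖ ^ 2 := fun k => by positivity
  have m2 : ∀ k, 0 ≤ τ * ‖y k - y₀‖ ^ 2 := fun k => by positivity
  have m3 : ∀ k, 0 ≤ c * ‖u k - u₀‖ ^ 2 := fun k => by positivity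
  have hρe : ∀ k, ρ k = c * ‖e k‖ ^ 2 + c * ‖u (k + 1) - u k‖ ^ 2 +
    (1 / γ - 1 / (2 * t) + 1 / γ) * ‖η k - u (k + 1)‖ ^ 2 + τ * ‖y k - y (k + 1)‖ ^ 2 +
    (τ⁻¹ * ((1 - α) / α)) * ‖r k - T (r k)‖ ^ 2 +
    (2 * (s' - s)) * ‖C (x k) - C x₀‖ ^ 2 + (2 * (t' - t)) * ‖d k - d₀‖ ^ 2 := fun k => rfl
  have he : Tendsto e atTop (𝓝 0) := tendsto_zero_of_mul_norm_sq_le hc (fun k => by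
    linarith [n2 k, n3 k, n4 k, n5 k, n6 k, n7 k, hρe k]) hρ
  have hub : ∃ M, ∀ k, ‖u k‖ ≤ M := exists_norm_le_of_mul_norm_sub_sq_le (a := u₀) (K := Φ 0) hc
    (fun k => by linarith [m1 k, m2 k, hle k, hlow k])
  have hub' : ∃ M, ∀ k, ‖u k - u₀‖ ≤ M := by
    obtain ⟨M, hM⟩ := hub
    exact ⟨M + ‖u₀‖, fun k => (norm_sub_le _ _).trans (by linarith [hM k])⟩
  refine ⟨⟨l, ?_⟩, ?_, ?_, hub, he, ?_, ?_, ?_, ?_, ?_, ?_⟩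
  -- The energy converges, and its two terms containing e tend to 0.
  · obtain ⟨M, hM⟩ := hub'
    have hLe : Tendsto (fun k => L (e k)) atTop (𝓝 0) := by
      have := (L.continuous.tendsto 0).comp he
      rwa [map_zero] at this
    have h1 := (hl.sub ((he.norm.pow 2).const_mul μ)).sub
      ((tendsto_inner_zero_of_bounded hM hLe).const_mul 2)
    simp only [norm_zero, ne_eq, OfNat.ofNat_ne_zero, not_false_eq_true, zero_pow, mul_zero,
      sub_zero] at h1
    refine h1.congr fun k => ?_
    simp only [hΦ_def, energy]
    ring
  · exact exists_norm_le_of_mul_norm_sub_sq_le (a := x₀) (K := Φ 0) hτi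
      (fun k => by linarith [m2 k, m3 k, hle k, hlow k])
  · exact exists_norm_le_of_mul_norm_sub_sq_le (a := y₀) (K := Φ 0) hτ
      (fun k => by linarith [m1 k, m3 k, hle k, hlow k])
  · exact tendsto_zero_of_mul_norm_sq_le hc (fun k => by
      linarith [n1 k, n3 k, n4 k, n5 k, n6 k, n7 k, hρe k]) hρ
  · exact tendsto_zero_of_mul_norm_sq_le hη (fun k => by
      linarith [n2 k, n1 k, n4 k, n5 k, n6 k, n7 k, hρe k]) hρ
  · exact tendsto_zero_of_mul_norm_sq_le hτ (fun k => by
      linarith [n2 k, n3 k, n1 k, n5 k, n6 k, n7 k, hρe k]) hρ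
  · exact tendsto_zero_of_mul_norm_sq_le (mul_pos hτi hα) (fun k => by
      linarith [n2 k, n3 k, n4 k, n1 k, n6 k, n7 k, hρe k]) hρ
  · exact tendsto_sub_nhds_zero_iff.1 (tendsto_zero_of_mul_norm_sq_le (mul_pos two_pos hs)
      (fun k => by linarith [n2 k, n3 k, n4 k, n5 k, n1 k, n7 k, hρe k]) hρ)
  · exact tendsto_sub_nhds_zero_iff.1 (tendsto_zero_of_mul_norm_sq_le (mul_pos two_pos ht)
      (fun k => by linarith [n2 k, n3 k, n4 k, n5 k, n6 k, n1 k, hρe k]) hρ)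

/-- Neither pairing alone passes to weak limits. In the sum, L contributes only ⟪u', L (x + e - r)⟫,
whose second factor tends to 0 along the orbit; every other term also has a strongly convergent
factor. -/
theorem inner_add_inner_partialInverse {x r y y' : H} {u u' η : G} (hx : x ∈ V)
    (hr : r ∈ V) (hy : y ∈ Vᗮ) (hy' : y' ∈ Vᗮ) (hη : ∀ z, ⟪η - u', L z⟫ = 0) (c e : H) (d : G) :
    ⟪r + τ • (y - y'), τ⁻¹ • (x - r) + y' -
        V.starProjection (ContinuousLinearMap.adjoint L u' + c)⟫ +
      ⟪γ⁻¹ • (u - η) + L (x + e) - d, η⟫ =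
    τ⁻¹ * ⟪r, x - r⟫ + τ * ⟪y', y - y'⟫ + γ⁻¹ * ⟪η, u - η⟫ + ⟪u', L (x + e - r)⟫ - ⟪r, c⟫ -
      ⟪η, d⟫ := by
  have hyV : τ • (y - y') ∈ Vᗮ := Vᗮ.smul_mem _ (Vᗮ.sub_mem hy hy')
  have h1 : ⟪τ • (y - y'), τ⁻¹ • (x - r)⟫ = 0 :=
    Submodule.inner_left_of_mem_orthogonal (V.smul_mem _ (V.sub_mem hx hr)) hyV
  have h2 : ⟪τ • (y - y'), V.starProjection (ContinuousLinearMap.adjoint L u' + c)⟫ = 0 :=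
    Submodule.inner_left_of_mem_orthogonal (V.starProjection_apply_mem _) hyV
  have h3 : ⟪r, y'⟫ = 0 := Submodule.inner_right_of_mem_orthogonal hr hy'
  have h4 : ⟪r, V.starProjection (ContinuousLinearMap.adjoint L u' + c)⟫ =
      ⟪u', L r⟫ + ⟪r, c⟫ := by
    rw [← Submodule.inner_starProjection_left_eq_right, Submodule.starProjection_eq_self_iff.2 hr,
      inner_add_right, ContinuousLinearMap.adjoint_inner_right, real_inner_comm]
  have h5 : ⟪L (x + e), η⟫ = ⟪u', L (x + e)⟫ := by
    have := hη (x + e)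
    rw [inner_sub_left] at this
    rw [real_inner_comm]
    linarith
  rw [inner_add_left r, inner_sub_right r, inner_sub_right (τ • (y - y')), inner_add_right r,
    inner_add_right (τ • (y - y')), h1, h2, h3, h4, inner_sub_left _ d, inner_add_left _ (L (x + e)),
    h5, map_sub L (x + e), inner_sub_right u', inner_smul_right r, inner_smul_left (u - η),
    inner_smul_left (y - y'), real_inner_comm y' (y - y'), real_inner_comm η (u - η),
    real_inner_comm η d]
  simp only [RCLike.conj_to_real]
  ring

theorem inner_add_inner_nonneg_of_weakTendsto {ι E F : Type*} [NormedAddCommGroup E]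
    [InnerProductSpace ℝ E] [NormedAddCommGroup F] [InnerProductSpace ℝ F] {l : Filter ι}
    [l.NeBot] {w w' : ι → E} {v v' : ι → F} {a a' z z' : E} {b b' q q' : F}
    (hw : WeakTendsto w l a) (hw' : WeakTendsto w' l a') (hv : WeakTendsto v l b)
    (hv' : WeakTendsto v' l b')
    (hsum : Tendsto (fun k => ⟪w k, w' k⟫ + ⟪v k, v' k⟫) l (𝓝 (⟪a, a'⟫ + ⟪b, b'⟫)))
    (h : ∀ k, 0 ≤ ⟪w k - z, w' k - z'⟫ + ⟪v k - q, v' k - q'⟫) :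
    0 ≤ ⟪a - z, a' - z'⟫ + ⟪b - q, b' - q'⟫ := by
  have expand : ∀ (a a' : E) (b b' : F), ⟪a - z, a' - z'⟫ + ⟪b - q, b' - q'⟫ =
      ⟪a, a'⟫ + ⟪b, b'⟫ - ⟪a, z'⟫ - ⟪a', z⟫ - ⟪b, q'⟫ - ⟪b', q⟫ + (⟪z, z'⟫ + ⟪q, q'⟫) := by
    intro a a' b b'
    rw [real_inner_comm z a', real_inner_comm q b']
    simp only [inner_sub_left, inner_sub_right]
    ring
  have hlim := ((((hsum.sub (hw z')).sub (hw' z)).sub (hv q')).sub (hv' q)).add_const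
    (⟪z, z'⟫ + ⟪q, q'⟫)
  rw [expand]
  refine ge_of_tendsto' hlim fun k => ?_
  rw [← expand]
  exact h k

/-- Weak cluster points of the iterates are solutions. -/
theorem IsOrbit.isKTPoint_of_weakTendsto (h : IsOrbit V W T L A B D C τ γ x y u d η r e)
    {x₀ y₀ : H} {u₀ d₀ : G} (hR : HasVanishingResiduals T C τ γ x y u d η r e x₀ y₀ u₀ d₀)
    {α s s' t t' : ℝ} (hP : IsAdmissible W T L A B D C τ γ α s s' t t') {l : Filter ℕ} [l.NeBot]
    (hl : l ≤ atTop) {a b : H} {v : G} (hx : WeakTendsto x l a) (hy : WeakTendsto y l b)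
    (hu : WeakTendsto u l v) : IsKTPoint V W T L A B D C a b v d₀ := by
  obtain ⟨Mx, hMx⟩ := hR.bdd_x
  obtain ⟨My, hMy⟩ := hR.bdd_y
  obtain ⟨Mu, hMu⟩ := hR.bdd_u
  have he1 : Tendsto (fun k => r k - x k) atTop (𝓝 0) :=
    (hR.e_tendsto.comp (tendsto_add_atTop_nat 1)).congr fun k => h.e_succ k
  obtain ⟨Mr, hMr⟩ : ∃ M, ∀ k, ‖r k‖ ≤ M := by
    simpa using exists_norm_le_add hR.bdd_x (exists_norm_le_of_tendsto he1)
  obtain ⟨Mη, hMη⟩ : ∃ M, ∀ k, ‖η k‖ ≤ M := by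
    simpa using exists_norm_le_add ⟨Mu, fun k => hMu (k + 1)⟩
      (exists_norm_le_of_tendsto hR.η_tendsto)
  have hr : WeakTendsto r l a := by simpa using hx.add_zero (he1.mono_left hl)
  have hu1 : WeakTendsto (fun k => u (k + 1)) l v := by
    simpa using hu.add_zero (hR.u_tendsto.mono_left hl)
  have hη : WeakTendsto η l v := by simpa using hu1.add_zero (hR.η_tendsto.mono_left hl)
  have hyd := hR.y_tendsto.mono_left hl
  have hy1 : WeakTendsto (fun k => y (k + 1)) l b := by
    simpa using hy.sub (.of_tendsto hyd)
  have hC := hR.C_tendsto.mono_left hl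
  have hd := hR.d_tendsto.mono_left hl
  have hxr : Tendsto (fun k => x k - r k) l (𝓝 0) := by simpa using (he1.mono_left hl).neg
  have huη : Tendsto (fun k => u k - η k) l (𝓝 0) := by
    simpa using ((hR.u_tendsto.add hR.η_tendsto).mono_left hl).neg
  have hxe : Tendsto (fun k => x k + e k - r k) l (𝓝 0) := by
    have := (hxr.add (hR.e_tendsto.mono_left hl))
    simp only [add_zero] at this
    exact this.congr fun k => by abel
  have haV : a ∈ V := hx.mem h.x_mem
  have hbV : b ∈ Vᗮ := hy.mem h.y_mem
  have hvW : v ∈ W := hu.mem h.u_mem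
  -- Cocoercivity at x k and a: the right side pairs x k - a ⇀ 0 with a strongly convergent
  -- sequence.
  have hCa : C a = C x₀ := by
    have h1 : Tendsto (fun k => s' * ‖C (x k) - C a‖ ^ 2) l (𝓝 (s' * ‖C x₀ - C a‖ ^ 2)) :=
      ((hC.sub_const (C a)).norm.pow 2).const_mul s'
    have h2 : Tendsto (fun k => ⟪x k - a, C (x k) - C a⟫) l (𝓝 0) := by
      have := (hx.inner_tendsto hMx (hC.sub_const (C a))).sub
        ((tendsto_const_nhds (x := a)).inner (hC.sub_const (C a)))
      simpa only [← inner_sub_left, sub_self, inner_zero_left] using this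
    have h3 := le_of_tendsto_of_tendsto' h1 h2 fun k => hP.coco (x k) a
    have hs' : 0 < s' := hP.s_pos.trans hP.s_lt
    have h4 : ‖C x₀ - C a‖ ^ 2 ≤ 0 := nonpos_of_mul_nonpos_right h3 hs'
    have h5 : ‖C x₀ - C a‖ = 0 := by nlinarith [norm_nonneg (C x₀ - C a)]
    exact (sub_eq_zero.1 (norm_eq_zero.1 h5)).symm
  -- The graph of D is closed for strong convergence of d and weak convergence of u.
  have hvD : v ∈ D d₀ := hP.maxD.mem_of_forall fun z z' hz => by
    have h1 : Tendsto (fun k => ⟪u k - z', d k - z⟫) l (𝓝 ⟪v - z', d₀ - z⟫) := by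
      have := (hu.inner_tendsto hMu (hd.sub_const z)).sub
        ((tendsto_const_nhds (x := z')).inner (hd.sub_const z))
      simpa only [← inner_sub_left] using this
    rw [real_inner_comm]
    refine ge_of_tendsto' h1 fun k => ?_
    rw [real_inner_comm]
    exact hP.maxD.1 (d k, u k) (h.d_mem k) (z, z') hz
  have hTa : T a = a := by
    refine hr.isFixedPt (fun p q => ?_) hMr (hR.r_tendsto.mono_left hl)
    have h1 := hP.averaged p q
    have h2 : 0 ≤ (1 - α) / α * ‖p - T p - (q - T q)‖ ^ 2 := by
      have := hP.averaged_pos; positivity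
    exact (pow_le_pow_iff_left₀ (norm_nonneg _) (norm_nonneg _) two_ne_zero).1 (by linarith)
  obtain ⟨hprimal, hdual⟩ := hP.maxA.mem_and_mem_of_forall hP.maxB (x := a)
    (a := b - V.starProjection (ContinuousLinearMap.adjoint L v + C a)) (u := L a - d₀) (b := v)
    (fun z z' hz q q' hq => by
      have hw : WeakTendsto (fun k => r k + τ • (y k - y (k + 1))) l a :=
        hr.add_zero (by simpa using hyd.const_smul τ)
      have ha : WeakTendsto (fun k => τ⁻¹ • (x k - r k) + y (k + 1) -
          V.starProjection (ContinuousLinearMap.adjoint L (u (k + 1)) + C (x k))) l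
          (b - V.starProjection (ContinuousLinearMap.adjoint L v + C a)) := by
        refine .sub ?_ (((hu1.map _).add (.of_tendsto (hCa ▸ hC))).map _)
        simpa using (WeakTendsto.of_tendsto (hxr.const_smul τ⁻¹)).add hy1
      have hb : WeakTendsto (fun k => γ⁻¹ • (u k - η k) + L (x k + e k) - d k) l (L a - d₀) := by
        refine .sub ?_ (.of_tendsto hd)
        simpa using (WeakTendsto.of_tendsto (huη.const_smul γ⁻¹)).add
          ((hx.add_zero (hR.e_tendsto.mono_left hl)).map L)
      have hsum : Tendsto (fun k => ⟪r k + τ • (y k - y (k + 1)), τ⁻¹ • (x k - r k) + y (k + 1) -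
          V.starProjection (ContinuousLinearMap.adjoint L (u (k + 1)) + C (x k))⟫ +
          ⟪γ⁻¹ • (u k - η k) + L (x k + e k) - d k, η k⟫) l
          (𝓝 (⟪a, b - V.starProjection (ContinuousLinearMap.adjoint L v + C a)⟫ +
            ⟪L a - d₀, v⟫)) := by
        have hLxe : Tendsto (fun k => L (x k + e k - r k)) l (𝓝 0) := by
          have := (L.continuous.tendsto 0).comp hxe
          rwa [map_zero] at this
        have h1 := ((((((tendsto_inner_zero_of_bounded hMr hxr).const_mul τ⁻¹).add
          ((tendsto_inner_zero_of_bounded (fun k => hMy (k + 1)) hyd).const_mul τ)).add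
          ((tendsto_inner_zero_of_bounded hMη huη).const_mul γ⁻¹)).add
          (tendsto_inner_zero_of_bounded (fun k => hMu (k + 1)) hLxe)).sub
          (hr.inner_tendsto hMr hC)).sub (hη.inner_tendsto hMη hd)
        -- The same identity at the limit point, with all increments and e equal to 0, evaluates the
        -- target.
        have h2 := inner_add_inner_partialInverse (L := L) (τ := τ) (γ := γ) haV haV hbV hbV
          (u := v) (η := v) (u' := v) (by simp) (C a) 0 d₀
        simp only [sub_self, smul_zero, add_zero, zero_add, inner_zero_right, mul_zero,
          map_zero] at h2
        rw [h2, hCa]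
        simp only [mul_zero, add_zero] at h1
        refine h1.congr fun k => (inner_add_inner_partialInverse (h.x_mem k) (h.r_mem k)
          (h.y_mem k) (h.y_mem (k + 1)) (fun z => ?_) _ _ _).symm
        rw [h.u_succ]
        exact Submodule.starProjection_inner_eq_zero _ _ (hP.map_mem z)
      exact inner_add_inner_nonneg_of_weakTendsto hw ha hb hη hsum fun k =>
        add_nonneg (hP.maxA.1 (_, _) (h.primal k) (z, z') hz)
          (hP.maxB.1 (_, _) (h.dual k) (q, q') hq))
  exact ⟨haV, hTa, hbV, hvW, hvD, hprimal, hdual⟩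

/-- Opial's argument: the weak cluster point of the iterates is unique. -/
theorem IsOrbit.exists_isKTPoint_weakTendsto (h : IsOrbit V W T L A B D C τ γ x y u d η r e)
    {x₀ y₀ : H} {u₀ d₀ : G} (h₀ : IsKTPoint V W T L A B D C x₀ y₀ u₀ d₀)
    {α s s' t t' : ℝ} (hP : IsAdmissible W T L A B D C τ γ α s s' t t') :
    ∃ a b v d₁, IsKTPoint V W T L A B D C a b v d₁ ∧ WeakTendsto x atTop a ∧
      WeakTendsto u atTop v := by
  have hR := h.hasVanishingResiduals h₀ hP
  have hex : ∀ 𝒰 : Ultrafilter ℕ, (𝒰 : Filter ℕ) ≤ atTop → ∃ a b v,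
      IsKTPoint V W T L A B D C a b v d₀ ∧ WeakTendsto x 𝒰 a ∧ WeakTendsto y 𝒰 b ∧
        WeakTendsto u 𝒰 v := by
    intro 𝒰 h𝒰
    obtain ⟨Mx, hMx⟩ := hR.bdd_x
    obtain ⟨My, hMy⟩ := hR.bdd_y
    obtain ⟨Mu, hMu⟩ := hR.bdd_u
    obtain ⟨a, ha⟩ := exists_weakTendsto_ultrafilter 𝒰 hMx
    obtain ⟨b, hb⟩ := exists_weakTendsto_ultrafilter 𝒰 hMy
    obtain ⟨v, hv⟩ := exists_weakTendsto_ultrafilter 𝒰 hMu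
    exact ⟨a, b, v, h.isKTPoint_of_weakTendsto hR hP h𝒰 ha hb hv, ha, hb, hv⟩
  obtain ⟨a, b, v, hKT, ha, hb, hv⟩ := hex (Ultrafilter.of atTop) (Ultrafilter.of_le _)
  -- The cluster point is itself a solution, so it can serve as a new reference point.
  obtain ⟨l₁, hl₁⟩ := (h.hasVanishingResiduals hKT hP).dist
  have huniq : ∀ 𝒰 : Ultrafilter ℕ, (𝒰 : Filter ℕ) ≤ atTop →
      WeakTendsto x 𝒰 a ∧ WeakTendsto u 𝒰 v := by
    intro 𝒰 h𝒰
    obtain ⟨a', b', v', hKT', ha', hb', hv'⟩ := hex 𝒰 h𝒰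
    obtain ⟨l₂, hl₂⟩ := (h.hasVanishingResiduals hKT' hP).dist
    -- The difference of the squared distances to two solutions is affine in the iterate, so this
    -- pairing converges along the whole sequence. Equating its limits along the two ultrafilters
    -- gives `hzero`.
    have hdiff : ∃ m, Tendsto (fun k => τ⁻¹ * ⟪x k, a' - a⟫ + γ⁻¹ * ⟪u k, v' - v⟫ +
        τ * ⟪y k, b' - b⟫) atTop (𝓝 m) := by
      refine ⟨_, (((hl₁.sub hl₂).sub_const (τ⁻¹ * (‖a‖ ^ 2 - ‖a'‖ ^ 2) +
        γ⁻¹ * (‖v‖ ^ 2 - ‖v'‖ ^ 2) + τ * (‖b‖ ^ 2 - ‖b'‖ ^ 2))).div_const 2).congr fun k => ?_⟩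
      have e1 := norm_sub_sq_sub_norm_sub_sq a a' (x k)
      have e2 := norm_sub_sq_sub_norm_sub_sq b b' (y k)
      have e3 := norm_sub_sq_sub_norm_sub_sq v v' (u k)
      linear_combination (τ⁻¹ * e1 + τ * e2 + γ⁻¹ * e3) / 2
    obtain ⟨m, hm⟩ := hdiff
    have hlim₁ := tendsto_nhds_unique (hm.mono_left (Ultrafilter.of_le _))
      ((((ha (a' - a)).const_mul τ⁻¹).add ((hv (v' - v)).const_mul γ⁻¹)).add
        ((hb (b' - b)).const_mul τ))
    have hlim₂ := tendsto_nhds_unique (hm.mono_left h𝒰)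
      ((((ha' (a' - a)).const_mul τ⁻¹).add ((hv' (v' - v)).const_mul γ⁻¹)).add
        ((hb' (b' - b)).const_mul τ))
    have hzero : τ⁻¹ * ‖a' - a‖ ^ 2 + γ⁻¹ * ‖v' - v‖ ^ 2 + τ * ‖b' - b‖ ^ 2 = 0 := by
      simp only [← real_inner_self_eq_norm_sq]
      rw [inner_sub_left a', inner_sub_left v', inner_sub_left b']
      linarith
    have hτ := hP.τ_pos
    have hγ := hP.γ_pos
    have n1 : 0 ≤ τ⁻¹ * ‖a' - a‖ ^ 2 := by positivity
    have n2 : 0 ≤ γ⁻¹ * ‖v' - v‖ ^ 2 := by positivity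
    have n3 : 0 ≤ τ * ‖b' - b‖ ^ 2 := by positivity
    have z1 : τ⁻¹ * ‖a' - a‖ ^ 2 = 0 := by linarith
    have z2 : γ⁻¹ * ‖v' - v‖ ^ 2 = 0 := by linarith
    have e1 : a' = a := by simpa [hτ.ne', sub_eq_zero] using z1
    have e2 : v' = v := by simpa [hγ.ne', sub_eq_zero] using z2
    exact ⟨e1 ▸ ha', e2 ▸ hv'⟩
  exact ⟨a, b, v, d₀, hKT, fun z => tendsto_iff_ultrafilter _ _ _ |>.2 fun 𝒰 h𝒰 =>
    (huniq 𝒰 h𝒰).1 z, fun z => tendsto_iff_ultrafilter _ _ _ |>.2 fun 𝒰 h𝒰 => (huniq 𝒰 h𝒰).2 z⟩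

end Convergence

/-! ### From set-valued formulation to graph inclusions -/

section Reformulation

variable {H G : Type*} [NormedAddCommGroup H] [InnerProductSpace ℝ H] [CompleteSpace H]
  [NormedAddCommGroup G] [InnerProductSpace ℝ G] [CompleteSpace G] {V : ClosedSubmodule ℝ H}
  {W : ClosedSubmodule ℝ G} {T : H → H} {L : H →L[ℝ] G} {A : H → Set H} {B D : G → Set G}
  {C : H → H}

theorem isSolution_iff_exists_isKTPoint {x : H} {u : G} : IsSolution V W T L A B D C x u ↔
    ∃ y d, IsKTPoint V.toSubmodule W.toSubmodule T L A B D C x y u d := by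
  constructor
  · rintro ⟨⟨hx, hT⟩, hu, hA, hB⟩
    obtain ⟨s, hs, v, hv, h0⟩ := Set.mem_add.1 hA
    obtain ⟨s', hs', q, hq, rfl⟩ := Set.mem_add.1 hs
    obtain ⟨a, ha, c, hc, rfl⟩ := Set.mem_add.1 hs'
    obtain ⟨p, hp, z, hz, h1⟩ := Set.mem_sub.1 hB
    obtain ⟨b, hb, d, hd, rfl⟩ := Set.mem_add.1 hp
    rw [Set.mem_singleton_iff] at hc hq hz
    subst hc hq hz
    have hv' : v ∈ V.toSubmoduleᗮ := (mem_normalCone_submodule (V := V.toSubmodule).1 hv).2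
    have hb' : b = L x - d := by rw [← sub_eq_zero, ← h1]; abel
    -- This choice is forced by the primal inclusion; it lies in Vᗮ because a + L*u + C x does.
    refine ⟨a + V.toSubmodule.starProjection (ContinuousLinearMap.adjoint L u + C x), d,
      hx, hT, ?_, hu, hd, by simpa using ha, hb' ▸ hb⟩
    have ha' : a = -(v + (ContinuousLinearMap.adjoint L u + C x)) := by
      rw [← sub_eq_zero, ← h0]; abel
    have : a + V.toSubmodule.starProjection (ContinuousLinearMap.adjoint L u + C x) =
        -(v + ((ContinuousLinearMap.adjoint L u + C x) -
          V.toSubmodule.starProjection (ContinuousLinearMap.adjoint L u + C x))) := by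
      rw [ha']; abel
    rw [this]
    exact Submodule.neg_mem _ (Submodule.add_mem _ hv'
      (Submodule.sub_starProjection_mem_orthogonal _))
  · rintro ⟨y, d, h⟩
    refine ⟨⟨h.x_mem, h.fixed⟩, h.u_mem, ?_, ?_⟩
    · refine Set.mem_add.2 ⟨_, Set.add_mem_add (Set.add_mem_add h.primal rfl) rfl,
        -(y + ((ContinuousLinearMap.adjoint L u + C x) -
          V.toSubmodule.starProjection (ContinuousLinearMap.adjoint L u + C x))), ?_, by abel⟩
      exact (mem_normalCone_submodule (V := V.toSubmodule)).2 ⟨h.x_mem, Submodule.neg_mem _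
        (Submodule.add_mem _ h.y_mem (Submodule.sub_starProjection_mem_orthogonal _))⟩
    · exact Set.mem_sub.2 ⟨_, Set.add_mem_add (show L x - d ∈ invOp B u from h.dual)
        (show d ∈ invOp D u from h.d_mem), L x, rfl, by abel⟩

/-- The orbit starts at index 1, since u 0 need not lie in W. The points η and r are shifted once
more because they are indexed by the step that uses them. -/
theorem IsGenerated.exists_isOrbit {τ γ : ℝ} (hτ : τ ≠ 0) (hγ : γ ≠ 0) {x xbar y : ℕ → H}
    {u η : ℕ → G} {w r : ℕ → H} (h : IsGenerated V W T L A B D C τ γ x xbar y u η w r) :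
    ∃ d, IsOrbit V.toSubmodule W.toSubmodule T L A B D C τ γ (fun k => x (k + 1))
      (fun k => y (k + 1)) (fun k => u (k + 1)) d (fun k => η (k + 2)) (fun k => r (k + 2))
      (fun k => r (k + 1) - x k) := by
  choose d hd hη using fun k => h.η_succ (k + 1)
  have hr : ∀ k, r (k + 1) ∈ V.toSubmodule := fun k => by
    rw [h.r_succ]; exact Submodule.starProjection_apply_mem _ _
  have hy : ∀ k, y k ∈ V.toSubmoduleᗮ := fun k => by
    induction k with
    | zero => exact h.y_zero
    | succ k ih =>
      rw [h.y_succ, h.r_succ, ← neg_sub (w (k + 1))]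
      exact Submodule.add_mem _ ih (Submodule.smul_mem _ _ (Submodule.neg_mem _
        (Submodule.sub_starProjection_mem_orthogonal _)))
  refine ⟨d, ?_, fun k => hy _, ?_, fun k => hr _, hd, fun k => ?_, fun k => h.u_succ _,
    fun k => ?_, fun k => h.x_succ _, fun k => rfl⟩
  · intro k
    simp only [h.x_succ]
    exact Submodule.starProjection_apply_mem _ _
  · intro k
    simp only [h.u_succ]
    exact Submodule.starProjection_apply_mem _ _
  · obtain ⟨b, hb, hbe⟩ := mem_resolventOp_smul (hη k)
    have : γ⁻¹ • (u (k + 1) - η (k + 2)) + L (x (k + 1) + (r (k + 1) - x k)) - d k = b := by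
      have e1 : γ • b = u (k + 1) - η (k + 2) + γ • (L (xbar (k + 1)) - d k) := by
        rw [← sub_eq_iff_eq_add'.2 hbe.symm]; abel
      rw [← inv_smul_smul₀ hγ b, e1, smul_add, inv_smul_smul₀ hγ, h.xbar_succ, add_sub_assoc,
        add_sub_assoc]
    have hb' : η (k + 2) ∈ B b := hb
    rwa [← this] at hb'
  · obtain ⟨a, ha, hae⟩ := mem_resolventOp_smul (h.w_succ (k + 1))
    -- The update of y records the Vᗮ component of w.
    have hw : r (k + 2) + τ • (y (k + 1) - y (k + 2)) = w (k + 2) := by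
      rw [h.y_succ (k + 1), sub_add_cancel_left, smul_neg, smul_inv_smul₀ hτ]; abel
    have : τ⁻¹ • (x (k + 1) - r (k + 2)) + y (k + 2) - V.toSubmodule.starProjection
        (ContinuousLinearMap.adjoint L (u (k + 2)) + C (x (k + 1))) = a := by
      rw [← inv_smul_smul₀ hτ a, ← sub_eq_iff_eq_add'.2 hae.symm, h.y_succ (k + 1)]
      simp only [smul_sub, smul_add, inv_smul_smul₀ hτ]
      abel
    rw [← this, ← hw] at ha
    exact ha

end Reformulation

end PartialInverse

/-! ### The convergence theorem -/

theorem theorem1 {H G : Type*}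
    [NormedAddCommGroup H] [InnerProductSpace ℝ H] [CompleteSpace H]
    [NormedAddCommGroup G] [InnerProductSpace ℝ G] [CompleteSpace G]
    (V : ClosedSubmodule ℝ H) (W : ClosedSubmodule ℝ G)
    (T : H → H) (α : ℝ) (hα : α ∈ Set.Ioo (0 : ℝ) 1)
    (hT : PartialInverse.IsAveragedNonexpansive α T)
    (L : H →L[ℝ] G) (hL : Set.range L ⊆ (W : Set G))
    (A : H → Set H) (hA : PartialInverse.IsMaximallyMonotone A)
    (B : G → Set G) (hB : PartialInverse.IsMaximallyMonotone B)
    (D : G → Set G) (hD : PartialInverse.IsMaximallyMonotone D)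
    (C : H → H) (β : ℝ≥0∞) (hβ : 0 < β) (hC : PartialInverse.IsCocoercive β C)
    (δ : ℝ≥0∞) (hδ : 0 < δ) (hDδ : PartialInverse.IsStronglyMonotone δ D)
    (hsol : ∃ x u, PartialInverse.IsSolution V W T L A B D C x u)
    (τ γ : ℝ) (hτ : 0 < τ) (hτβ : ENNReal.ofReal τ < 2 * β)
    (hγ : 0 < γ) (hγδ : ENNReal.ofReal γ < 2 * δ)
    (hLnorm : ‖L‖ ^ 2 < (1 / τ - (1 / (2 * β)).toReal) * (1 / γ - (1 / (2 * δ)).toReal))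
    (x xbar y : ℕ → H) (u η : ℕ → G) (w r : ℕ → H)
    (hgen : PartialInverse.IsGenerated V W T L A B D C τ γ x xbar y u η w r) :
    ∃ (xhat : H) (uhat : G), PartialInverse.IsSolution V W T L A B D C xhat uhat ∧
      Tendsto (fun k => toWeakSpace ℝ (H × G) (x k, u k)) atTop
        (𝓝 (toWeakSpace ℝ (H × G) (xhat, uhat))) := by
  -- One ε is taken from both factors of the strict inequality and pays for the reduced moduli s and
  -- t.
  obtain ⟨ε, hε, hετ, hεγ, hlt⟩ := PartialInverse.exists_slack
    (PartialInverse.toReal_one_div_lt hτ hτβ) (PartialInverse.toReal_one_div_lt hγ hγδ) hLnorm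
  obtain ⟨s, s', hs, hss', hs'β, hsε⟩ := PartialInverse.exists_moduli hβ hε
  obtain ⟨t, t', ht, htt', ht'δ, htε⟩ := PartialInverse.exists_moduli hδ hε
  have hP : PartialInverse.IsAdmissible W.toSubmodule T L A B D C τ γ α s s' t t' := {
    averaged := hT
    averaged_pos := div_pos (sub_pos.2 hα.2) hα.1
    map_mem := fun z => hL ⟨z, rfl⟩
    maxA := hA
    maxB := hB
    maxD := hD
    τ_pos := hτ
    γ_pos := hγ
    s_pos := hs
    s_lt := hss'
    t_pos := ht
    t_lt := htt'
    coco := fun p q => PartialInverse.real_mul_le_of_ereal_mul_le hs'β (hs.trans hss').le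
      (by positivity) (hC p q)
    strong := fun p q v hv w hw => PartialInverse.real_mul_le_of_ereal_mul_le ht'δ
      (ht.trans htt').le (by positivity) (hDδ (p, v) hv (q, w) hw)
    primal_pos := by rw [hsε]; linarith
    dual_pos := by rw [htε]; linarith
    norm_sq_lt := by rwa [hsε, htε, ← sub_sub, ← sub_sub] }
  obtain ⟨x₀, u₀, h₀⟩ := hsol
  obtain ⟨y₀, d₀, h₀⟩ := PartialInverse.isSolution_iff_exists_isKTPoint.1 h₀
  obtain ⟨d, hd⟩ := hgen.exists_isOrbit hτ.ne' hγ.ne'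
  obtain ⟨a, b, v, d₁, hKT, hx, hu⟩ := hd.exists_isKTPoint_weakTendsto h₀ hP
  exact ⟨a, v, PartialInverse.isSolution_iff_exists_isKTPoint.2 ⟨b, d₁, hKT⟩,
    (tendsto_add_atTop_iff_nat 1).1 (PartialInverse.tendsto_toWeakSpace_prod hx hu)⟩
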